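/- Let $G=(V,E)$ be a Laman graph, i.e. a finite simple graph with $|E|=2|V|-3$ such that every subgraph $(V',E')$ with $|V'|\ge 2$ satisfies $|E'|\le 2|V'|-3$. A labeling of $G$ is a function $\lambda\colon E\to\mathbb{C}$; a realization $\rho\colon V\to\mathbb{C}^2$ is compatible with $\lambda$ if $\lambda(\{u,v\})=\langle\rho(u)-\rho(v),\rho(u)-\rho(v)\rangle$ for every edge $\{u,v\}$, where $\langle x,y\rangle=x_1y_1+x_2y_2$. Two realizations are equivalent if they differ by a direct isometry $p\mapsto Ap+b$ of $\mathbb{C}^2$, where $A\in\mathbb{C}^{2\times2}$, $AA^{T}=I$, $\det A=1$ and $b\in\mathbb{C}^2$. A bigraph is a pair $B=(G_1,G_2)$ of finite undirected graphs (several components, multiple edges and self-loops allowed) on vertex sets $V_1,V_2$ with a common set $\mathcal{E}$ of edges. For $i=1,2$, let $L_i\subseteq\mathbb{C}^{V_i}$ be the subspace of functions that are constant on every connected component of $G_i$. The bigraph $B$ defines a rational map $$f_B\colon \mathbb{P}(\mathbb{C}^{V_1}/L_1)\times\mathbb{P}(\mathbb{C}^{V_2}/L_2)\dashrightarrow\mathbb{P}(\mathbb{C}^{\mathcal{E}}),\qquad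 ([x],[y])\mapsto\bigl[(x_u-x_v)(y_t-y_w)\bigr]_{e\in\mathcal{E}},$$ where $e$ joins $u,v$ in $G_1$ and $t,w$ in $G_2$ (the order of the endpoints of each edge being fixed). The Laman number $\operatorname{Lam}(B)$ is the degree of $f_B$: the number of points of the fiber of $f_B$ over a general point of $\mathbb{P}(\mathbb{C}^{\mathcal{E}})$ (so it is $0$ if $f_B$ is not dominant); it is set to $0$ if there is no such finite number. Then the map $f_{(G,G)}$ of the bigraph $(G,G)$ has a degree in this sense, and for a general labeling $\lambda$ of $G$ (that is, for all $\lambda$ in a non-empty Zariski-open subset of $\mathbb{C}^{E}$) the number of equivalence classes of realizations of $G$ compatible with $\lambda$ is finite and equal to $\operatorname{Lam}(G,G)$. -/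

import Mathlib

open scoped LinearAlgebra.Projectivization Matrix

noncomputable section

namespace LamanCount

/-! ### Laman graphs -/

/-- A finite simple graph `G = (V, E)` is a Laman graph if `|E| = 2|V| - 3` and every subgraph
`(V', E')` with at least two vertices has `|E'| ≤ 2|V'| - 3`. (Such a graph is connected.) -/
def IsLaman {V : Type*} [Fintype V] (G : SimpleGraph V) : Prop :=
  (G.edgeSet.ncard : ℤ) = 2 * (Fintype.card V : ℤ) - 3 ∧
    ∀ G' : G.Subgraph, 2 ≤ G'.verts.ncard →
      (G'.edgeSet.ncard : ℤ) ≤ 2 * (G'.verts.ncard : ℤ) - 3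

/-! ### Complex realizations -/

/-- A labeling of `G`: a function from the edges to `ℂ`. -/
abbrev Labeling {V : Type*} (G : SimpleGraph V) : Type _ := G.edgeSet → ℂ

/-- A realization: a function from the vertices to `ℂ²`. -/
abbrev Realization (V : Type*) : Type _ := V → (Fin 2 → ℂ)

/-- `ρ` is compatible with `l` if `l {u,v} = ⟨ρ u - ρ v, ρ u - ρ v⟩` for every edge `{u,v}`, where
`⟨x, y⟩ = x₁ y₁ + x₂ y₂` (bilinear, without conjugation). -/
def Compatible {V : Type*} {G : SimpleGraph V} (l : Labeling G) (ρ : Realization V) : Prop :=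
  ∀ (u v : V) (h : G.Adj u v), l ⟨s(u, v), h⟩ = (ρ u - ρ v) ⬝ᵥ (ρ u - ρ v)

/-- Two realizations are equivalent if a direct isometry `p ↦ A p + b` of `ℂ²`, with `A` complex
orthogonal of determinant `1`, maps one to the other. -/
def Equivalent {V : Type*} (ρ τ : Realization V) : Prop :=
  ∃ (A : Matrix (Fin 2) (Fin 2) ℂ) (b : Fin 2 → ℂ),
    A * Aᵀ = 1 ∧ A.det = 1 ∧ ∀ v, τ v = A *ᵥ ρ v + b

theorem Equivalent.refl {V : Type*} (ρ : Realization V) : Equivalent ρ ρ :=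
  ⟨1, 0, by simp, by simp, by simp⟩

theorem Equivalent.symm {V : Type*} {ρ τ : Realization V} (h : Equivalent ρ τ) :
    Equivalent τ ρ := by
  obtain ⟨A, b, hA, hd, h⟩ := h
  have hA' : Aᵀ * A = 1 := mul_eq_one_comm.mp hA
  refine ⟨Aᵀ, -(Aᵀ *ᵥ b), by simpa using hA', by simpa using hd, fun v => ?_⟩
  rw [h v, Matrix.mulVec_add, Matrix.mulVec_mulVec, hA', Matrix.one_mulVec, add_neg_cancel_right]

theorem Equivalent.trans {V : Type*} {ρ τ σ : Realization V} (h : Equivalent ρ τ)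
    (h' : Equivalent τ σ) : Equivalent ρ σ := by
  obtain ⟨A, b, hA, hd, h⟩ := h
  obtain ⟨B, c, hB, hd', h'⟩ := h'
  refine ⟨B * A, B *ᵥ b + c, ?_, by simp [hd, hd'], fun v => ?_⟩
  · rw [Matrix.transpose_mul, Matrix.mul_assoc, ← Matrix.mul_assoc A, hA, Matrix.one_mul, hB]
  · rw [h' v, h v, Matrix.mulVec_add, Matrix.mulVec_mulVec, add_assoc]

/-- Equivalence of realizations as a setoid. -/
def realizationSetoid (V : Type*) : Setoid (Realization V) where
  r := Equivalent
  iseqv := ⟨Equivalent.refl, Equivalent.symm, Equivalent.trans⟩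

/-- The set of equivalence classes of realizations compatible with `l`. -/
def realizationClasses {V : Type*} {G : SimpleGraph V} (l : Labeling G) :
    Set (Quotient (realizationSetoid V)) :=
  (fun ρ => Quotient.mk (realizationSetoid V) ρ) '' {ρ | Compatible l ρ}

/-- `P` holds for a general labeling: on a non-empty Zariski-open (hence dense open) set of the
vector space of all labelings. -/
def ForGeneralLabeling {V : Type*} {G : SimpleGraph V} (P : Labeling G → Prop) : Prop :=
  ∃ F : MvPolynomial G.edgeSet ℂ, F ≠ 0 ∧ ∀ l : Labeling G, MvPolynomial.eval l F ≠ 0 → P l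

/-! ### Bigraphs and their Laman numbers -/

/-- A bigraph: two undirected graphs on vertex sets `V` and `W`, possibly with several components,
multiple edges and self-loops, with a common set `ε` of (bi)edges. Finiteness of `V`, `W`, `ε` is
required where it is needed. -/
structure Bigraph (V W ε : Type*) where
  /-- endpoints in the left graph -/
  left : ε → Sym2 V
  /-- endpoints in the right graph -/
  right : ε → Sym2 W

/-- The bigraph `(G, G)`. -/
def Bigraph.diag {V : Type*} (G : SimpleGraph V) : Bigraph V V G.edgeSet where
  left e := e.1
  right e := e.1

/-- The linear map `x ↦ (x u - x v)_{e = {u, v}}`. The order of the two endpoints is chosen once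
for every unordered pair; another choice changes signs of coordinates only. -/
def edgeDiff {V ε : Type*} (ends : ε → Sym2 V) : (V → ℂ) →ₗ[ℂ] (ε → ℂ) where
  toFun x := fun e => x (Quot.out (ends e)).1 - x (Quot.out (ends e)).2
  map_add' x y := by
    funext e
    simp only [Pi.add_apply]
    ring
  map_smul' c x := by
    funext e
    simp only [Pi.smul_apply, smul_eq_mul, RingHom.id_apply]
    ring

/-- `ℂ^V` modulo the functions that are constant on every connected component, that is, modulo the
kernel of `edgeDiff`. For finite `V` its dimension is `|V|` minus the number of components. -/
abbrev PosSpace {V ε : Type*} (ends : ε → Sym2 V) : Type _ :=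
  (V → ℂ) ⧸ LinearMap.ker (edgeDiff ends)

/-- The edge differences on the quotient. -/
def quotDiff {V ε : Type*} (ends : ε → Sym2 V) : PosSpace ends →ₗ[ℂ] (ε → ℂ) :=
  (LinearMap.ker (edgeDiff ends)).liftQ (edgeDiff ends) le_rfl

namespace Bigraph

variable {V W ε : Type*} (B : Bigraph V W ε)

/-- The vector `((x_u - x_v) (y_t - y_w))_e`, where `e` joins `u, v` in the left graph and `t, w` in
the right graph. -/
def prodVec (x : PosSpace B.left) (y : PosSpace B.right) : ε → ℂ :=
  fun e => quotDiff B.left x e * quotDiff B.right y e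

/-- The fiber over `p` of the rational map from `ℙ(ℂ^V / ~) × ℙ(ℂ^W / ~)` to `ℙ(ℂ^ε)` sending
`([x], [y])` to `[(x_u - x_v) (y_t - y_w)]_e`; it is defined where this vector is not zero. -/
def fiber (p : ℙ ℂ (ε → ℂ)) : Set (ℙ ℂ (PosSpace B.left) × ℙ ℂ (PosSpace B.right)) :=
  {q | ∃ h : B.prodVec q.1.rep q.2.rep ≠ 0,
    Projectivization.mk ℂ (B.prodVec q.1.rep q.2.rep) h = p}

/-- The rational map of `B` has degree `d`: over a general point of `ℙ(ℂ^ε)`, that is, off the zero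
set of some nonzero homogeneous polynomial, its fiber has exactly `d` points. In particular a map
that is not dominant has degree `0`. -/
def HasDegree (d : ℕ) : Prop :=
  ∃ (n : ℕ) (F : MvPolynomial ε ℂ), F.IsHomogeneous n ∧ F ≠ 0 ∧
    ∀ p : ℙ ℂ (ε → ℂ), MvPolynomial.eval p.rep F ≠ 0 → (B.fiber p).encard = d

/-- The Laman number of a bigraph: the degree of its rational map (`0` if the map is not generically
finite). -/
def lamanNumber : ℕ := sInf {d | B.HasDegree d}

end Bigraph

end LamanCount

end

/-! In the isotropic coordinates x = ρ₁ + iρ₂, y = ρ₁ - iρ₂ the squared length of an edge becomes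
(x_u - x_v)(y_u - y_v), and direct isometries become (x, y) ↦ (αx + b, α⁻¹y + c). Fix an edge {v₁,
v₀} and a labeling l without zeros. Both counts are then equal to the number of normalized
solutions: x and y vanish at v₀ and x is 1 at v₁. For realizations, b and c move v₀ to the origin
and α scales x at v₁ to 1 (`encard_realizationClasses`). For the fiber over [l], connectedness of G
leaves only additive constants in the kernel of the edge differences; x and y may then be scaled
independently, and the extra freedom is used up by turning "proportional to l" into "equal to l"
(`encard_fiber`).

It remains to see that this number is generically constant. The normalized system is a polynomial
map between affine spaces of dimension |E| = 2|V| - 3. If its components are algebraically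
dependent, general fibers are empty. Otherwise the polynomial ring is algebraic over the subalgebra
they generate, a primitive element exists after inverting one element of the base, and general
fibers correspond to the roots of a separable specialization of one polynomial
(`exists_encard_fiber_eq`). The genericity condition so obtained is not homogeneous;
`exists_isHomogeneous_forall_exists_eval_smul_ne_zero` passes to projective space by moving l along
its line. Sparsity of subgraphs is needed only for connectedness. -/

namespace LamanCount

/-! ### Generic fibers of generically finite algebras -/

section GenericFiber

open Polynomial

/-- A ring homomorphism `ev : T → Ω` extends along `ψ : T → S` if it kills the kernel of `ψ` and
`S` lies in the image of `ψ` after inverting an element with nonzero value. -/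
theorem exists_ringHom_comp_eq {T S Ω : Type*} [CommRing T] [CommRing S] [Field Ω]
    (ψ : T →+* S) (ev : T →+* Ω) (hker : ∀ t, ψ t = 0 → ev t = 0) (a : T) (ha : ev a ≠ 0)
    (hS : ∀ s, ∃ (k : ℕ) (t : T), ψ a ^ k * s = ψ t) : ∃ g : S →+* Ω, g.comp ψ = ev := by
  choose k t hkt using hS
  have heq : ∀ x y, ψ x = ψ y → ev x = ev y := fun x y h => by
    have := hker (x - y) (by rw [map_sub, h, sub_self])
    rwa [map_sub, sub_eq_zero] at this
  -- The candidate value does not depend on the chosen fraction; each ring homomorphism axiom is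
  -- then one choice of fraction.
  have key : ∀ (s : S) (j : ℕ) (u : T), ψ a ^ j * s = ψ u →
      ev (t s) / ev a ^ k s = ev u / ev a ^ j := by
    intro s j u h
    rw [div_eq_div_iff (pow_ne_zero _ ha) (pow_ne_zero _ ha), ← map_pow, ← map_pow, ← map_mul,
      ← map_mul]
    apply heq
    rw [map_mul, map_mul, ← hkt, ← h, map_pow, map_pow]
    ring
  refine ⟨{ toFun := fun s => ev (t s) / ev a ^ k s
            map_one' := ?_, map_mul' := ?_, map_zero' := ?_, map_add' := ?_ }, ?_⟩
  · simpa using key 1 0 1 (by simp)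
  · intro s s'
    rw [key (s * s') (k s + k s') (t s * t s')
      (by rw [map_mul, ← hkt, ← hkt]; ring), map_mul, pow_add, mul_div_mul_comm]
  · simpa using key 0 0 0 (by simp)
  · intro s s'
    rw [key (s + s') (k s + k s') (a ^ k s' * t s + a ^ k s * t s')
      (by rw [map_add, map_mul, map_mul, ← hkt, ← hkt, map_pow, map_pow]; ring),
      map_add, map_mul, map_mul, map_pow, map_pow, pow_add,
      div_add_div _ _ (pow_ne_zero _ ha) (pow_ne_zero _ ha)]
    ring
  · ext u
    simpa using key (ψ u) 0 u (by simp)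

variable {R S : Type*} [CommRing R] [CommRing S] [Algebra R S] [FaithfulSMul R S]

/-- If `m` has minimal degree among the nonzero polynomials killing `θ`, then every root of a
specialization of `m` with nonvanishing leading coefficient is a root of the specialization of every
polynomial killing `θ`. -/
theorem eval₂_eq_zero_of_aeval_eq_zero {Ω : Type*} [Field Ω] {θ : S} {m : R[X]}
    (hm : aeval θ m = 0)
    (hmin : ∀ q : R[X], q ≠ 0 → aeval θ q = 0 → m.natDegree ≤ q.natDegree)
    (f : R →+* Ω) (hf : f m.leadingCoeff ≠ 0) {z : Ω} (hz : eval₂ f z m = 0) :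
    ∀ q : R[X], aeval θ q = 0 → eval₂ f z q = 0 := by
  intro q
  induction hn : q.natDegree using Nat.strong_induction_on generalizing q with
  | _ n ih =>
    intro hq
    by_cases hq0 : q = 0
    · simp [hq0]
    have hle := hmin q hq0 hq
    by_cases hnd : q.natDegree = 0
    · obtain ⟨c, rfl⟩ := natDegree_eq_zero.mp hnd
      rw [aeval_C, map_eq_zero_iff _ (FaithfulSMul.algebraMap_injective R S)] at hq
      simp [hq]
    -- One step of pseudo-division by `m`: the degree of `q` drops, and at `z` only the term `lc(m)
    -- * q` survives, its power of `X` being trivial by minimality.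
    have hlt := natDegree_cancelLeads_lt_of_natDegree_le_natDegree hle (Nat.pos_of_ne_zero hnd)
    have h1 := ih _ (hn ▸ hlt) (m.cancelLeads q) rfl
      (by simp [cancelLeads, hm, hq])
    simp only [cancelLeads, eval₂_sub, eval₂_mul, eval₂_C, eval₂_pow, eval₂_X, hz, mul_zero,
      sub_zero] at h1
    have h2 : m.natDegree - q.natDegree = 0 := by omega
    rw [h2, pow_zero, mul_one] at h1
    exact (mul_eq_zero.mp h1).resolve_left hf

variable [IsDomain R] [IsDomain S] [Algebra.IsAlgebraic R S]

/-- A finitely generated algebraic extension of domains of characteristic zero is generated by one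
element after inverting some nonzero element of the base. -/
theorem exists_generically_primitive [CharZero R] [Algebra.FiniteType R S] :
    ∃ (θ : S) (h : R), h ≠ 0 ∧
      ∀ s : S, ∃ (k : ℕ) (q : R[X]), algebraMap R S h ^ k * s = aeval θ q := by
  let K := FractionRing R
  let L := FractionRing S
  let _ : Algebra K L := FractionRing.liftAlgebra R L
  have : CharZero K := charZero_of_injective_algebraMap (IsFractionRing.injective R K)
  have : Algebra.IsAlgebraic K L := inferInstance
  have : Algebra.EssFiniteType S L := .of_isLocalization L (nonZeroDivisors S)
  have : Algebra.EssFiniteType R L := .comp R S L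
  have : Algebra.EssFiniteType K L := .of_comp R K L
  have : FiniteDimensional K L := by
    obtain ⟨s, hs⟩ := IntermediateField.fg_top K L
    have := IntermediateField.finiteDimensional_adjoin (K := K) (L := L) (S := (s : Set L))
      (fun x _ => Algebra.IsIntegral.isIntegral x)
    rw [hs] at this
    exact IntermediateField.topEquiv.toLinearEquiv.finiteDimensional
  obtain ⟨α, hα⟩ := Field.exists_primitive_element K L
  -- As `S` is algebraic over `R`, denominators in `L` can be taken from `R`.
  obtain ⟨θ, r, hr0, hr⟩ : ∃ (θ : S) (r : R), r ≠ 0 ∧ algebraMap S L θ = algebraMap R L r * α := by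
    obtain ⟨⟨θ, r, hr⟩, h⟩ := IsLocalization.surj
      (Algebra.algebraMapSubmonoid S (nonZeroDivisors R)) α
    obtain ⟨r, hr', rfl⟩ := hr
    refine ⟨θ, r, nonZeroDivisors.ne_zero hr', ?_⟩
    rw [← h, mul_comm, ← IsScalarTower.algebraMap_apply]
  have hθ : ∀ x : L, ∃ p : K[X], x = aeval (algebraMap S L θ) p := by
    intro x
    have hx : x ∈ IntermediateField.adjoin K {algebraMap S L θ} := by
      have : α ∈ IntermediateField.adjoin K {algebraMap S L θ} := by
        have h0 : algebraMap K L (algebraMap R K r) ≠ 0 := by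
          simpa using hr0
        have : α = (algebraMap K L (algebraMap R K r))⁻¹ * algebraMap S L θ := by
          rw [hr, IsScalarTower.algebraMap_apply R K L, inv_mul_cancel_left₀ h0]
        rw [this]
        exact mul_mem (inv_mem (algebraMap_mem _ _))
          (IntermediateField.mem_adjoin_simple_self K _)
      have h2 : IntermediateField.adjoin K {α} ≤ IntermediateField.adjoin K {algebraMap S L θ} :=
        IntermediateField.adjoin_le_iff.mpr (by simpa using this)
      exact h2 (hα ▸ IntermediateField.mem_top)
    rw [← IntermediateField.mem_toSubalgebra,
      IntermediateField.adjoin_simple_toSubalgebra_of_isAlgebraic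
        (Algebra.IsAlgebraic.isAlgebraic _), Algebra.adjoin_singleton_eq_range_aeval] at hx
    obtain ⟨p, hp⟩ := hx
    exact ⟨p, hp.symm⟩
  have hloc : ∀ s : S, ∃ b : R, b ≠ 0 ∧ ∃ q : R[X], algebraMap R S b * s = aeval θ q := by
    intro s
    obtain ⟨p, hp⟩ := hθ (algebraMap S L s)
    obtain ⟨b, hb, hbp⟩ := IsLocalization.integerNormalization_spec (nonZeroDivisors R) p
    refine ⟨b, nonZeroDivisors.ne_zero hb,
      IsLocalization.integerNormalization (nonZeroDivisors R) p, ?_⟩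
    apply IsFractionRing.injective S L
    rw [map_mul, hp, ← aeval_algebraMap_apply,
      ← aeval_map_algebraMap (A := K) _ (IsLocalization.integerNormalization _ p), hbp,
      ← algebraMap_smul K b p, map_smul, Algebra.smul_def, ← IsScalarTower.algebraMap_apply,
      ← IsScalarTower.algebraMap_apply]
  choose b hb0 q hq using hloc
  obtain ⟨G, hG⟩ := (Algebra.FiniteType.out : (⊤ : Subalgebra R S).FG)
  -- One common denominator for a finite generating set suffices; its powers serve sums and
  -- products.
  refine ⟨θ, ∏ s ∈ G, b s, Finset.prod_ne_zero_iff.mpr fun s _ => hb0 s, fun s => ?_⟩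
  have hs : s ∈ Algebra.adjoin R (G : Set S) := hG ▸ Algebra.mem_top
  induction hs using Algebra.adjoin_induction with
  | mem s hs =>
    classical
    refine ⟨1, C (∏ s ∈ G.erase s, b s) * q s, ?_⟩
    rw [← Finset.mul_prod_erase G b (Finset.mem_coe.mp hs), map_mul, map_mul, aeval_C, ← hq]
    ring
  | algebraMap r => exact ⟨0, C r, by simp⟩
  | add x y _ _ hx hy =>
    obtain ⟨k, p, hp⟩ := hx
    obtain ⟨k', p', hp'⟩ := hy
    refine ⟨k + k', C (∏ s ∈ G, b s) ^ k' * p + C (∏ s ∈ G, b s) ^ k * p', ?_⟩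
    rw [map_add, map_mul, map_mul, ← hp, ← hp', map_pow, map_pow, aeval_C]
    ring
  | mul x y _ _ hx hy =>
    obtain ⟨k, p, hp⟩ := hx
    obtain ⟨k', p', hp'⟩ := hy
    refine ⟨k + k', p * p', ?_⟩
    rw [map_mul, ← hp, ← hp']
    ring

variable (R S) in
/-- A finitely generated algebraic extension `R ⊆ S` of domains of characteristic zero has a
degree: over a general geometric point of `R`, the number of geometric points of `S` is
constant. -/
theorem exists_encard_fiber_eq [CharZero R] [Algebra.FiniteType R S] (Ω : Type*) [Field Ω]
    [IsAlgClosed Ω] :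
    ∃ (d : ℕ) (h : R), h ≠ 0 ∧ ∀ f : R →+* Ω, f h ≠ 0 →
      {g : S →+* Ω | g.comp (algebraMap R S) = f}.encard = d := by
  classical
  obtain ⟨θ, h, h0, hgen⟩ := exists_generically_primitive (R := R) (S := S)
  obtain ⟨m, ⟨hm0, hm⟩, hmin⟩ : ∃ m : R[X], (m ≠ 0 ∧ aeval θ m = 0) ∧
      ∀ q : R[X], q ≠ 0 → aeval θ q = 0 → m.natDegree ≤ q.natDegree := by
    have hne : {q : R[X] | q ≠ 0 ∧ aeval θ q = 0}.Nonempty := Algebra.IsAlgebraic.isAlgebraic θ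
    obtain ⟨m, hm, hmin⟩ := (measure (natDegree (R := R))).wf.has_min _ hne
    exact ⟨m, hm, fun q hq hq' => not_lt.mp (hmin q ⟨hq, hq'⟩)⟩
  have hmd : m.natDegree ≠ 0 := by
    intro hd
    obtain ⟨c, rfl⟩ := natDegree_eq_zero.mp hd
    rw [aeval_C, map_eq_zero_iff _ (FaithfulSMul.algebraMap_injective R S)] at hm
    exact hm0 (by simp [hm])
  -- Characteristic zero makes the derivative nonzero, and its degree is too small to kill `θ`.
  have hder : aeval θ (derivative m) ≠ 0 := by
    intro h'
    have hd0 : derivative m ≠ 0 := fun h0 => hmd (derivative_eq_zero.mp h0)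
    exact absurd (hmin _ hd0 h') (not_le.mpr (natDegree_derivative_lt hmd))
  obtain ⟨c, r, hr0, hr⟩ := Algebra.IsAlgebraic.exists_smul_eq_mul R (1 : S) hder
  -- `h` makes a point of the fiber determined by its value at `θ`, the leading coefficient
  -- preserves the degree, and `r`, a multiple of m'(θ), excludes multiple roots.
  refine ⟨m.natDegree, h * m.leadingCoeff * r,
    mul_ne_zero (mul_ne_zero h0 (leadingCoeff_ne_zero.mpr hm0)) hr0, fun f hf => ?_⟩
  rw [map_mul, map_mul] at hf
  have hfh := left_ne_zero_of_mul (left_ne_zero_of_mul hf)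
  have hfm := right_ne_zero_of_mul (left_ne_zero_of_mul hf)
  have hfr := right_ne_zero_of_mul hf
  have hev : ∀ g : S →+* Ω, g.comp (algebraMap R S) = f → ∀ q : R[X],
      g (aeval θ q) = eval₂ f (g θ) q := by
    rintro g rfl q
    rw [aeval_def, hom_eval₂]
  have hinj : Set.InjOn (fun g : S →+* Ω => g θ) {g | g.comp (algebraMap R S) = f} := by
    intro g hg g' hg' hgg
    ext s
    obtain ⟨k, q, hq⟩ := hgen s
    have e1 := congrArg g hq
    have e2 := congrArg g' hq
    rw [hev g hg, map_mul, map_pow, ← RingHom.comp_apply, hg] at e1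
    rw [hev g' hg', map_mul, map_pow, ← RingHom.comp_apply, hg'] at e2
    dsimp only at hgg
    rw [hgg, ← e2] at e1
    exact mul_left_cancel₀ (pow_ne_zero _ hfh) e1
  have hfm0 : m.map f ≠ 0 := fun h' => hfm (by
    have := congrArg (fun p => p.coeff m.natDegree) h'
    simpa using this)
  have himg : (fun g : S →+* Ω => g θ) '' {g | g.comp (algebraMap R S) = f} =
      ((m.map f).roots.toFinset : Set Ω) := by
    ext z
    simp only [Set.mem_image, Set.mem_ofPred_eq, Finset.mem_coe, Multiset.mem_toFinset,
      mem_roots hfm0, IsRoot.def, eval_map]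
    constructor
    · rintro ⟨g, hg, rfl⟩
      rw [← hev g hg, hm, map_zero]
    · intro hz
      obtain ⟨g, hg⟩ := exists_ringHom_comp_eq (aeval θ : R[X] →ₐ[R] S).toRingHom (eval₂RingHom f z)
        (fun q hq => eval₂_eq_zero_of_aeval_eq_zero hm hmin f hfm hz q hq) (C h)
        (by simpa using hfh) (fun s => by simpa using hgen s)
      refine ⟨g, ?_, ?_⟩
      · ext x
        simpa using congrArg (fun φ : R[X] →+* Ω => φ (C x)) hg
      · simpa using congrArg (fun φ : R[X] →+* Ω => φ X) hg
  have hnodup : (m.map f).roots.Nodup := by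
    rw [Multiset.nodup_iff_count_le_one]
    intro z
    by_contra! hz
    rw [count_roots, one_lt_rootMultiplicity_iff_isRoot hfm0, derivative_map] at hz
    have hz1 : z ∈ ((m.map f).roots.toFinset : Set Ω) := by
      simpa [hfm0] using hz.1
    rw [← himg] at hz1
    obtain ⟨g, hg, rfl⟩ := hz1
    have h1 := congrArg g hr
    have h2 := hz.2
    rw [IsRoot.def, eval_map, ← hev g hg] at h2
    rw [Algebra.smul_def, mul_one, map_mul, h2, zero_mul, ← RingHom.comp_apply, hg] at h1
    exact hfr h1
  rw [← hinj.encard_image, himg, Set.encard_coe_eq_coe_finsetCard,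
    Multiset.toFinset_card_of_nodup hnodup, ← (IsAlgClosed.splits (m.map f)).natDegree_eq_card_roots,
    natDegree_map_of_leadingCoeff_ne_zero _ hfm]

end GenericFiber

/-! ### Degrees of polynomial maps between affine spaces of equal dimension -/

section PolynomialMap

open MvPolynomial

theorem eval_comp_aeval {σ τ : Type*} (Φ : σ → MvPolynomial τ ℂ) (x : τ → ℂ) :
    (eval x).comp (aeval Φ : MvPolynomial σ ℂ →ₐ[ℂ] MvPolynomial τ ℂ) =
      eval fun e => eval x (Φ e) := by
  ext e <;> simp

/-- A polynomial map `ℂ^τ → ℂ^σ` between spaces of equal dimension has a degree: the number of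
points of a general fiber. -/
theorem exists_encard_polynomialMap_fiber_eq {σ τ : Type*} [Finite σ] [Finite τ]
    (hcard : Nat.card σ = Nat.card τ) (Φ : σ → MvPolynomial τ ℂ) :
    ∃ (d : ℕ) (F : MvPolynomial σ ℂ), F ≠ 0 ∧ ∀ l : σ → ℂ, eval l F ≠ 0 →
      {x : τ → ℂ | ∀ e, eval x (Φ e) = l e}.encard = d := by
  by_cases hΦ : AlgebraicIndependent ℂ Φ
  · have htr : IsTranscendenceBasis ℂ Φ := by
      apply hΦ.isTranscendenceBasis_of_lift_trdeg_le_of_finite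
      rw [MvPolynomial.trdeg_of_isDomain]
      have : Fintype σ := Fintype.ofFinite σ
      have : Fintype τ := Fintype.ofFinite τ
      simp only [Nat.card_eq_fintype_card] at hcard
      simp [hcard]
    have : Algebra.IsAlgebraic (Algebra.adjoin ℂ (Set.range Φ)) (MvPolynomial τ ℂ) :=
      htr.isAlgebraic
    have : Algebra.FiniteType (Algebra.adjoin ℂ (Set.range Φ)) (MvPolynomial τ ℂ) :=
      .of_restrictScalars_finiteType ℂ _ _
    obtain ⟨d, h, h0, hd⟩ := exists_encard_fiber_eq
      (Algebra.adjoin ℂ (Set.range Φ)) (MvPolynomial τ ℂ) ℂ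
    refine ⟨d, hΦ.aevalEquiv.symm h, by simpa using h0, fun l hl => ?_⟩
    have hcomp : ∀ p : MvPolynomial σ ℂ, algebraMap _ (MvPolynomial τ ℂ) (hΦ.aevalEquiv p) =
        aeval Φ p := hΦ.algebraMap_aevalEquiv
    let f : Algebra.adjoin ℂ (Set.range Φ) →+* ℂ :=
      (eval l).comp (hΦ.aevalEquiv.symm : _ →+* MvPolynomial σ ℂ)
    rw [← hd f hl]
    have hiff : ∀ x : τ → ℂ, (∀ e, eval x (Φ e) = l e) ↔
        (eval x).comp (algebraMap (Algebra.adjoin ℂ (Set.range Φ)) (MvPolynomial τ ℂ)) = f := by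
      intro x
      constructor
      · intro hx
        ext r
        obtain ⟨p, rfl⟩ := hΦ.aevalEquiv.surjective r
        simp only [RingHom.comp_apply, hcomp, f]
        have := congrArg (fun g : MvPolynomial σ ℂ →+* ℂ => g p) (eval_comp_aeval Φ x)
        simpa [show l = fun e => eval x (Φ e) from funext fun e => (hx e).symm] using this
      · intro hx e
        have := congrArg (fun g : _ →+* ℂ => g (hΦ.aevalEquiv (X e))) hx
        simpa [hcomp, f] using this
    have hinj : Function.Injective (fun x : τ → ℂ => (eval x : MvPolynomial τ ℂ →+* ℂ)) := by
      intro x y hxy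
      funext i
      simpa using congrArg (fun g : MvPolynomial τ ℂ →+* ℂ => g (X i)) hxy
    rw [← hinj.encard_image]
    congr 1
    ext g
    constructor
    · rintro ⟨x, hx, rfl⟩
      exact (hiff x).mp hx
    · intro hg
      -- Extending `f` forces `g` to fix the constants, so `g` is evaluation at a point.
      have hgx : eval (fun i => g (X i)) = g := by
        ext i
        · have := congrArg (fun φ : _ →+* ℂ => φ (hΦ.aevalEquiv (C i))) hg
          simpa [hcomp, f] using this.symm
        · simp
      refine ⟨fun i => g (X i), (hiff _).mpr ?_, hgx⟩
      rw [hgx]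
      exact hg
  · rw [algebraicIndependent_iff] at hΦ
    push Not at hΦ
    obtain ⟨F, hF, hF0⟩ := hΦ
    -- An algebraic relation vanishes on the whole image.
    refine ⟨0, F, hF0, fun l hl => ?_⟩
    rw [Nat.cast_zero, Set.encard_eq_zero, Set.eq_empty_iff_forall_notMem]
    intro x hx
    apply hl
    rw [show l = fun e => eval x (Φ e) from funext fun e => (hx e).symm, ← eval_comp_aeval,
      RingHom.comp_apply, RingHom.coe_coe, hF, map_zero]

end PolynomialMap

end LamanCount

noncomputable section

namespace LamanCount

/-! ### Laman graphs are connected -/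

/-- The Laman bound is weakened by one so that it also covers single vertices. -/
theorem IsLaman.ncard_edgeSet_induce_le {V : Type*} [Fintype V] {G : SimpleGraph V}
    (hG : IsLaman G) (S : Set V) (hS : S.Nonempty) :
    (((⊤ : G.Subgraph).induce S).edgeSet.ncard : ℤ) ≤ 2 * (S.ncard : ℤ) - 2 := by
  by_cases h2 : 2 ≤ S.ncard
  · have := hG.2 ((⊤ : G.Subgraph).induce S) (by simpa using h2)
    simp only [SimpleGraph.Subgraph.induce_verts] at this
    omega
  · have h1 : S.ncard = 1 := by
      have := (Set.ncard_pos (Set.toFinite S)).mpr hS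
      omega
    obtain ⟨a, rfl⟩ := Set.ncard_eq_one.mp h1
    have : ((⊤ : G.Subgraph).induce {a}).edgeSet = ∅ := by
      rw [Set.eq_empty_iff_forall_notMem]
      intro e
      induction e using Sym2.ind with
      | _ u v =>
        simp only [SimpleGraph.Subgraph.mem_edgeSet, SimpleGraph.Subgraph.induce_adj,
          Set.mem_singleton_iff, SimpleGraph.Subgraph.top_adj]
        rintro ⟨rfl, rfl, h⟩
        exact G.loopless.irrefl _ h
    simp [this]

/-- No edge leaves a component, so the bounds for a component and a nonempty complement would add up
to |E| ≤ 2|V| - 4. -/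
theorem IsLaman.preconnected {V : Type*} [Fintype V] {G : SimpleGraph V} (hG : IsLaman G) :
    G.Preconnected := by
  by_contra hcon
  simp only [SimpleGraph.Preconnected, not_forall] at hcon
  obtain ⟨u, v, huv⟩ := hcon
  set A : Set V := {w | G.Reachable u w} with hA
  have hu : A.Nonempty := ⟨u, SimpleGraph.Reachable.refl u⟩
  have hv : Aᶜ.Nonempty := ⟨v, huv⟩
  have h1 := hG.ncard_edgeSet_induce_le A hu
  have h2 := hG.ncard_edgeSet_induce_le Aᶜ hv
  have hsub : G.edgeSet ⊆ ((⊤ : G.Subgraph).induce A).edgeSet ∪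
      ((⊤ : G.Subgraph).induce Aᶜ).edgeSet := by
    intro e
    induction e using Sym2.ind with
    | _ a b =>
      intro hab
      rw [SimpleGraph.mem_edgeSet] at hab
      have hiff : a ∈ A ↔ b ∈ A :=
        ⟨fun h => h.trans hab.reachable, fun h => h.trans hab.symm.reachable⟩
      by_cases ha : a ∈ A
      · left
        simp [ha, hiff.mp ha, hab]
      · right
        simp [ha, mt hiff.mpr ha, hab]
  have h3 := (Set.ncard_le_ncard hsub (Set.toFinite _)).trans (Set.ncard_union_le _ _)
  have h4 := Set.ncard_add_ncard_compl A
  rw [Nat.card_eq_fintype_card] at h4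
  have h5 := hG.1
  omega

theorem IsLaman.exists_adj {V : Type*} [Fintype V] {G : SimpleGraph V} (hG : IsLaman G) :
    ∃ v w, G.Adj v w := by
  by_contra! hcon
  have : G.edgeSet = ∅ := by
    rw [Set.eq_empty_iff_forall_notMem]
    intro e
    induction e using Sym2.ind with
    | _ a b => exact hcon a b
  have h := hG.1
  rw [this, Set.ncard_empty] at h
  omega

/-! ### Edge differences -/

section EdgeDiff

variable {V : Type*} {G : SimpleGraph V}

/-- The product of the edge differences of two functions on the vertices. -/
def edgeProd (G : SimpleGraph V) (x y : V → ℂ) : G.edgeSet → ℂ :=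
  fun e => edgeDiff (fun e : G.edgeSet => e.1) x e * edgeDiff (fun e : G.edgeSet => e.1) y e

/-- The chosen orientation of an edge enters both factors, so the signs cancel. -/
theorem edgeProd_mk (x y : V → ℂ) {u v : V} (h : G.Adj u v) :
    edgeProd G x y ⟨s(u, v), h⟩ = (x u - x v) * (y u - y v) := by
  have hout : Sym2.mk (Quot.out s(u, v)).1 (Quot.out s(u, v)).2 = s(u, v) := Quot.out_eq _
  simp only [edgeProd, edgeDiff, LinearMap.coe_mk, AddHom.coe_mk]
  rcases Sym2.eq_iff.mp hout with ⟨h1, h2⟩ | ⟨h1, h2⟩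
  · rw [h1, h2]
  · rw [h1, h2]
    ring

theorem edgeProd_eq_iff (x y : V → ℂ) (l : Labeling G) :
    edgeProd G x y = l ↔
      ∀ (u v : V) (h : G.Adj u v), (x u - x v) * (y u - y v) = l ⟨s(u, v), h⟩ := by
  constructor
  · rintro rfl u v h
    exact (edgeProd_mk x y h).symm
  · intro h
    funext ⟨e, he⟩
    induction e using Sym2.ind with
    | _ u v => exact (edgeProd_mk x y he).trans (h u v he)

theorem mem_ker_edgeDiff_iff (x : V → ℂ) :
    x ∈ LinearMap.ker (edgeDiff fun e : G.edgeSet => e.1) ↔ ∀ u v, G.Adj u v → x u = x v := by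
  have : x ∈ LinearMap.ker (edgeDiff fun e : G.edgeSet => e.1) ↔ edgeProd G x x = 0 := by
    rw [LinearMap.mem_ker, funext_iff, funext_iff]
    simp [edgeProd]
  rw [this, edgeProd_eq_iff]
  simp [sub_eq_zero]

theorem const_mem_ker_edgeDiff (c : ℂ) :
    (fun _ => c) ∈ LinearMap.ker (edgeDiff fun e : G.edgeSet => e.1) :=
  (mem_ker_edgeDiff_iff _).mpr fun _ _ _ => rfl

theorem eq_of_mem_ker_edgeDiff (hG : G.Preconnected) {x : V → ℂ}
    (hx : x ∈ LinearMap.ker (edgeDiff fun e : G.edgeSet => e.1)) (u v : V) : x u = x v := by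
  rw [mem_ker_edgeDiff_iff] at hx
  obtain ⟨p⟩ := hG u v
  induction p with
  | nil => rfl
  | cons h _ ih => exact (hx _ _ h).trans ih

end EdgeDiff

/-! ### Normalized solutions -/

/-- The solutions `(x, y)` of `(x_u - x_v) (y_u - y_v) = l {u, v}` with `x` and `y` vanishing at one
vertex and `x` taking the value `1` at another. -/
def normalizedSolutions {V : Type*} {G : SimpleGraph V} (v₀ v₁ : V) (l : Labeling G) :
    Set ((V → ℂ) × (V → ℂ)) :=
  {z | z.1 v₀ = 0 ∧ z.2 v₀ = 0 ∧ z.1 v₁ = 1 ∧ edgeProd G z.1 z.2 = l}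

section PolynomialSystem

open MvPolynomial

variable {V : Type*} [DecidableEq V]

/-- The indices of the coordinates of a pair `(x, y)` that a normalization leaves free. -/
abbrev FreeCoord (v₀ v₁ : V) : Type _ := {v : V // v ≠ v₀ ∧ v ≠ v₁} ⊕ {v : V // v ≠ v₀}

/-- The coordinate `x_v` as a polynomial in the free coordinates. -/
def leftCoord (v₀ v₁ v : V) : MvPolynomial (FreeCoord v₀ v₁) ℂ :=
  if h₀ : v = v₀ then 0 else if h₁ : v = v₁ then 1 else X (.inl ⟨v, h₀, h₁⟩)

/-- The coordinate `y_v` as a polynomial in the free coordinates. -/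
def rightCoord (v₀ v₁ v : V) : MvPolynomial (FreeCoord v₀ v₁) ℂ :=
  if h₀ : v = v₀ then 0 else X (.inr ⟨v, h₀⟩)

theorem card_freeCoord [Fintype V] {v₀ v₁ : V} (h : v₁ ≠ v₀) :
    (Nat.card (FreeCoord v₀ v₁) : ℤ) = 2 * (Fintype.card V : ℤ) - 3 := by
  have h1 : Fintype.card {v : V // v ≠ v₀} + 1 = Fintype.card V := by
    have := Fintype.card_subtype_compl (fun v : V => v = v₀)
    rw [Fintype.card_subtype_eq] at this
    have h3 : 0 < Fintype.card V := Fintype.card_pos_iff.mpr ⟨v₀⟩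
    simp only [ne_eq]
    omega
  have h2 : Fintype.card {v : V // v ≠ v₀ ∧ v ≠ v₁} + 2 = Fintype.card V := by
    rw [Fintype.card_subtype]
    have : (Finset.univ.filter fun v : V => v ≠ v₀ ∧ v ≠ v₁) = ({v₀, v₁} : Finset V)ᶜ := by
      ext v
      simp
    rw [this, ← Finset.card_pair h.symm, Finset.card_compl_add_card]
  rw [Nat.card_eq_fintype_card, Fintype.card_sum]
  omega

theorem encard_normalizedSolutions {G : SimpleGraph V} {v₀ v₁ : V} (h : v₁ ≠ v₀)
    (l : Labeling G) :
    (normalizedSolutions v₀ v₁ l).encard =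
      {z : FreeCoord v₀ v₁ → ℂ | ∀ e : G.edgeSet,
        eval z (((leftCoord v₀ v₁ (Quot.out e.1).1 - leftCoord v₀ v₁ (Quot.out e.1).2)) *
          (rightCoord v₀ v₁ (Quot.out e.1).1 - rightCoord v₀ v₁ (Quot.out e.1).2)) = l e}.encard := by
  let φ : (FreeCoord v₀ v₁ → ℂ) → (V → ℂ) × (V → ℂ) := fun z =>
    (fun v => eval z (leftCoord v₀ v₁ v), fun v => eval z (rightCoord v₀ v₁ v))
  have hφ : Function.Injective φ := by
    intro z z' hz
    funext i
    rcases i with ⟨v, h₀, h₁⟩ | ⟨v, h₀⟩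
    · simpa [φ, leftCoord, h₀, h₁] using congrFun (congrArg Prod.fst hz) v
    · simpa [φ, rightCoord, h₀] using congrFun (congrArg Prod.snd hz) v
  rw [← hφ.encard_image]
  congr 1
  ext ⟨x, y⟩
  constructor
  · rintro ⟨hx₀, hy₀, hx₁, hl⟩
    have hxy : φ (Sum.elim (fun v => x v) fun v => y v) = (x, y) := by
      refine Prod.ext (funext fun v => ?_) (funext fun v => ?_)
      · by_cases h₀ : v = v₀
        · subst h₀
          simpa [φ, leftCoord] using hx₀.symm
        by_cases h₁ : v = v₁
        · subst h₁
          simpa [φ, leftCoord, h₀] using hx₁.symm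
        simp [φ, leftCoord, h₀, h₁]
      · by_cases h₀ : v = v₀
        · subst h₀
          simpa [φ, rightCoord] using hy₀.symm
        simp [φ, rightCoord, h₀]
    refine ⟨_, fun e => ?_, hxy⟩
    have hx := fun v => congrFun (congrArg Prod.fst hxy) v
    have hy := fun v => congrFun (congrArg Prod.snd hxy) v
    simp only [φ] at hx hy
    simp only [map_mul, map_sub, hx, hy]
    exact congrFun hl e
  · rintro ⟨z, hz, hzxy⟩
    obtain ⟨rfl, rfl⟩ := Prod.mk.inj hzxy
    refine ⟨by simp [leftCoord], by simp [rightCoord], by simp [leftCoord, h], ?_⟩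
    funext e
    rw [← hz e, map_mul, map_sub, map_sub]
    rfl

end PolynomialSystem

/-- The number of normalized solutions for a general labeling of a Laman graph. -/
theorem IsLaman.exists_encard_normalizedSolutions_eq {V : Type*} [Fintype V] {G : SimpleGraph V}
    (hG : IsLaman G) {v₀ v₁ : V} (h : v₁ ≠ v₀) :
    ∃ (d : ℕ) (F : MvPolynomial G.edgeSet ℂ), F ≠ 0 ∧ ∀ l : Labeling G,
      MvPolynomial.eval l F ≠ 0 → (normalizedSolutions v₀ v₁ l).encard = d := by
  classical
  have hcard : Nat.card G.edgeSet = Nat.card (FreeCoord v₀ v₁) := by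
    have h1 := card_freeCoord h
    have h2 := hG.1
    rw [← Nat.card_coe_set_eq] at h2
    omega
  obtain ⟨d, F, hF, hd⟩ := exists_encard_polynomialMap_fiber_eq hcard fun e : G.edgeSet =>
    ((leftCoord v₀ v₁ (Quot.out e.1).1 - leftCoord v₀ v₁ (Quot.out e.1).2)) *
      (rightCoord v₀ v₁ (Quot.out e.1).1 - rightCoord v₀ v₁ (Quot.out e.1).2)
  exact ⟨d, F, hF, fun l hl => (encard_normalizedSolutions h l).trans (hd l hl)⟩

/-! ### Realizations in isotropic coordinates -/

section Realization

variable {V : Type*}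

/-- The realization with isotropic coordinates `x = ρ₁ + i ρ₂` and `y = ρ₁ - i ρ₂`. -/
def ofIsotropic (x y : V → ℂ) : Realization V :=
  fun v => ![(x v + y v) / 2, (x v - y v) / (2 * Complex.I)]

theorem ofIsotropic_surjective (ρ : Realization V) : ∃ x y, ofIsotropic x y = ρ := by
  refine ⟨fun v => ρ v 0 + Complex.I * ρ v 1, fun v => ρ v 0 - Complex.I * ρ v 1, ?_⟩
  funext v i
  fin_cases i
  · simp [ofIsotropic]
  · simp only [ofIsotropic, Fin.mk_one, Matrix.cons_val_one, Matrix.cons_val_fin_one]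
    field_simp
    ring

theorem compatible_ofIsotropic_iff {G : SimpleGraph V} (l : Labeling G) (x y : V → ℂ) :
    Compatible l (ofIsotropic x y) ↔ edgeProd G x y = l := by
  rw [edgeProd_eq_iff]
  refine forall₃_congr fun u v h => ?_
  have : (ofIsotropic x y u - ofIsotropic x y v) ⬝ᵥ (ofIsotropic x y u - ofIsotropic x y v) =
      (x u - x v) * (y u - y v) := by
    simp only [ofIsotropic, dotProduct, Fin.sum_univ_two, Pi.sub_apply, Matrix.cons_val_zero,
      Matrix.cons_val_one, Matrix.cons_val_fin_one]
    field_simp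
    rw [Complex.I_sq]
    ring
  rw [this, eq_comm]

theorem entries_of_mul_transpose_eq_one {A : Matrix (Fin 2) (Fin 2) ℂ} (hA : A * Aᵀ = 1) (hd : A.det = 1) :
    A 1 1 = A 0 0 ∧ A 1 0 = -A 0 1 := by
  -- Both are inverse to `A`, the determinant being 1.
  have h : A.adjugate = Aᵀ := by
    rw [← Matrix.mul_one A.adjugate, ← hA, ← Matrix.mul_assoc, Matrix.adjugate_mul, hd, one_smul,
      Matrix.one_mul]
  rw [Matrix.adjugate_fin_two] at h
  have h1 := congrFun (congrFun h 0) 0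
  have h2 := congrFun (congrFun h 0) 1
  simp only [Matrix.of_apply, Matrix.cons_val_zero, Matrix.cons_val_one, Matrix.cons_val_fin_one,
    Matrix.cons_val', Matrix.transpose_apply] at h1 h2
  exact ⟨h1, h2.symm⟩

/-- In isotropic coordinates the direct isometries are the maps
`(x, y) ↦ (α x + b, α⁻¹ y + c)`. -/
theorem equivalent_ofIsotropic_iff (x y x' y' : V → ℂ) :
    Equivalent (ofIsotropic x y) (ofIsotropic x' y') ↔
      ∃ α b c : ℂ, α ≠ 0 ∧ ∀ v, x' v = α * x v + b ∧ y' v = α⁻¹ * y v + c := by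
  have hI : Complex.I ^ 2 = -1 := Complex.I_sq
  have hdiv : ∀ z : ℂ, z / (2 * Complex.I) = -(Complex.I * z) / 2 := by
    intro z
    field_simp
    linear_combination z * hI
  constructor
  · rintro ⟨A, t, hA, hd, h⟩
    obtain ⟨h1, h2⟩ := entries_of_mul_transpose_eq_one hA hd
    rw [Matrix.det_fin_two, h1, h2] at hd
    have hα : (A 0 0 - Complex.I * A 0 1) * (A 0 0 + Complex.I * A 0 1) = 1 := by
      linear_combination hd - A 0 1 ^ 2 * hI
    have hα0 := left_ne_zero_of_mul_eq_one hα
    refine ⟨A 0 0 - Complex.I * A 0 1, t 0 + Complex.I * t 1, t 0 - Complex.I * t 1, hα0,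
      fun v => ?_⟩
    rw [← eq_inv_of_mul_eq_one_right hα]
    have e0 := congrFun (h v) 0
    have e1 := congrFun (h v) 1
    simp only [ofIsotropic, Matrix.cons_val_zero, Matrix.cons_val_one, Matrix.cons_val_fin_one,
      Pi.add_apply, Matrix.mulVec, dotProduct, Fin.sum_univ_two, h1, h2] at e0 e1
    simp only [hdiv] at e0 e1
    constructor
    · linear_combination e0 + Complex.I * e1 + ((x' v - y' v) / 2 - A 0 0 * (x v - y v) / 2) * hI
    · linear_combination e0 - Complex.I * e1 - ((x' v - y' v) / 2 - A 0 0 * (x v - y v) / 2) * hI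
  · rintro ⟨α, b, c, hα, h⟩
    refine ⟨!![(α + α⁻¹) / 2, (α⁻¹ - α) / (2 * Complex.I);
      (α - α⁻¹) / (2 * Complex.I), (α + α⁻¹) / 2], ![(b + c) / 2, (b - c) / (2 * Complex.I)],
      ?_, ?_, fun v => ?_⟩
    · ext i j
      fin_cases i <;> fin_cases j <;> simp [Matrix.mul_apply, Fin.sum_univ_two] <;> field_simp <;>
        ring_nf <;> simp [hI] <;> ring
    · rw [Matrix.det_fin_two_of]
      field_simp
      simp only [hI]
      ring
    · funext i
      fin_cases i
      · simp [ofIsotropic, (h v).1, (h v).2]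
        field_simp
        simp only [hI]
        ring
      · simp [ofIsotropic, (h v).1, (h v).2]
        field_simp
        ring

/-- Every compatible realization is equivalent to exactly one normalized solution. -/
theorem encard_realizationClasses {G : SimpleGraph V} {v₀ v₁ : V} (h : G.Adj v₁ v₀)
    (l : Labeling G) (hl : ∀ e, l e ≠ 0) :
    (realizationClasses l).encard = (normalizedSolutions v₀ v₁ l).encard := by
  let φ : (V → ℂ) × (V → ℂ) → Quotient (realizationSetoid V) :=
    fun z => Quotient.mk (realizationSetoid V) (ofIsotropic z.1 z.2)
  have hφ : Set.InjOn φ (normalizedSolutions v₀ v₁ l) := by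
    rintro ⟨x, y⟩ ⟨hx₀, hy₀, hx₁, -⟩ ⟨x', y'⟩ ⟨hx₀', hy₀', hx₁', -⟩ heq
    obtain ⟨α, b, c, -, hv⟩ := (equivalent_ofIsotropic_iff x y x' y').mp (Quotient.exact heq)
    dsimp only at hx₀ hy₀ hx₁ hx₀' hy₀' hx₁'
    have hb : b = 0 := by
      have := (hv v₀).1
      rw [hx₀, hx₀'] at this
      simpa using this.symm
    have hα : α = 1 := by
      have := (hv v₁).1
      rw [hx₁, hx₁', hb] at this
      simpa using this.symm
    have hc : c = 0 := by
      have := (hv v₀).2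
      rw [hy₀, hy₀'] at this
      simpa using this.symm
    subst hb hα hc
    refine Prod.ext (funext fun v => ?_) (funext fun v => ?_)
    · simpa using (hv v).1.symm
    · simpa using (hv v).2.symm
  rw [← hφ.encard_image]
  congr 1
  ext q
  constructor
  · rintro ⟨ρ, hρ, rfl⟩
    obtain ⟨x, y, rfl⟩ := ofIsotropic_surjective ρ
    have hxy := (edgeProd_eq_iff x y l).mp ((compatible_ofIsotropic_iff l x y).mp hρ)
    -- The label of this edge is nonzero, so x can be scaled to 1 at `v₁`.
    have hα : x v₁ - x v₀ ≠ 0 := left_ne_zero_of_mul ((hxy v₁ v₀ h).trans_ne (hl _))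
    refine ⟨(fun v => (x v₁ - x v₀)⁻¹ * (x v - x v₀), fun v => (x v₁ - x v₀) * (y v - y v₀)),
      ⟨by simp, by simp, inv_mul_cancel₀ hα, ?_⟩, ?_⟩
    · rw [edgeProd_eq_iff]
      intro u v huv
      rw [← hxy u v huv]
      field_simp
      ring
    · refine Quotient.sound (s := realizationSetoid V) (Equivalent.symm ?_)
      rw [equivalent_ofIsotropic_iff]
      refine ⟨(x v₁ - x v₀)⁻¹, -((x v₁ - x v₀)⁻¹ * x v₀), -((x v₁ - x v₀) * y v₀),
        inv_ne_zero hα, fun v => ⟨by ring, by rw [inv_inv]; ring⟩⟩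
  · rintro ⟨⟨x, y⟩, ⟨-, -, -, hxy⟩, rfl⟩
    exact ⟨ofIsotropic x y, (compatible_ofIsotropic_iff l x y).mpr hxy, rfl⟩

end Realization

/-! ### Fibers of the rational map -/

section Fiber

variable {V : Type*} {G : SimpleGraph V}

theorem prodVec_mk (x y : V → ℂ) :
    (Bigraph.diag G).prodVec (Submodule.Quotient.mk x) (Submodule.Quotient.mk y) =
      edgeProd G x y := rfl

theorem prodVec_smul_smul (a b : ℂ) (x : PosSpace (Bigraph.diag G).left)
    (y : PosSpace (Bigraph.diag G).right) :
    (Bigraph.diag G).prodVec (a • x) (b • y) = (a * b) • (Bigraph.diag G).prodVec x y := by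
  funext e
  simp only [Bigraph.prodVec, map_smul, Pi.smul_apply, smul_eq_mul]
  ring

theorem mk_ne_zero_of_edgeProd_ne_zero {x y : V → ℂ} (h : edgeProd G x y ≠ 0) :
    (Submodule.Quotient.mk x : PosSpace (Bigraph.diag G).left) ≠ 0 ∧
      (Submodule.Quotient.mk y : PosSpace (Bigraph.diag G).right) ≠ 0 := by
  rw [← prodVec_mk] at h
  constructor
  · rintro h0
    apply h
    rw [h0]
    funext e
    simp [Bigraph.prodVec]
  · rintro h0
    apply h
    rw [h0]
    funext e
    simp [Bigraph.prodVec]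

theorem mk_mem_fiber {x y : V → ℂ} {l : Labeling G} (hl : l ≠ 0) (h : edgeProd G x y = l)
    (hx : (Submodule.Quotient.mk x : PosSpace (Bigraph.diag G).left) ≠ 0)
    (hy : (Submodule.Quotient.mk y : PosSpace (Bigraph.diag G).right) ≠ 0) :
    (Projectivization.mk ℂ _ hx, Projectivization.mk ℂ _ hy) ∈
      (Bigraph.diag G).fiber (Projectivization.mk ℂ l hl) := by
  obtain ⟨a, ha⟩ := Projectivization.exists_smul_eq_mk_rep ℂ _ hx
  obtain ⟨b, hb⟩ := Projectivization.exists_smul_eq_mk_rep ℂ _ hy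
  have key : (Bigraph.diag G).prodVec (Projectivization.mk ℂ _ hx).rep
      (Projectivization.mk ℂ _ hy).rep = ((a : ℂ) * b) • l := by
    rw [← ha, ← hb, ← h, ← prodVec_mk]
    exact prodVec_smul_smul _ _ _ _
  have hab : (a : ℂ) * b ≠ 0 := mul_ne_zero a.ne_zero b.ne_zero
  refine ⟨key.trans_ne (smul_ne_zero hab hl), ?_⟩
  rw [Projectivization.mk_eq_mk_iff']
  exact ⟨(a : ℂ) * b, key.symm⟩

/-- On a connected graph a class is a function up to an additive constant, which vanishing at `v₀`
fixes. -/
theorem mk_eq_mk_iff_of_preconnected (hG : G.Preconnected) {x x' : V → ℂ} {v₀ : V}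
    (hx : x v₀ = 0) (hx' : x' v₀ = 0) (a : ℂ) :
    a • (Submodule.Quotient.mk x' : PosSpace fun e : G.edgeSet => e.1) =
      Submodule.Quotient.mk x ↔ x = a • x' := by
  rw [← Submodule.Quotient.mk_smul, Submodule.Quotient.eq]
  constructor
  · intro h
    funext v
    have := eq_of_mem_ker_edgeDiff hG h v v₀
    simp only [Pi.sub_apply, Pi.smul_apply, hx, hx', smul_zero, sub_zero, sub_eq_zero] at this
    exact this.symm
  · rintro rfl
    simp

/-- Every point of the fiber over `[l]` has exactly one normalized representative. -/
theorem encard_fiber (hG : G.Preconnected) {v₀ v₁ : V} (h : G.Adj v₁ v₀)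
    (l : Labeling G) (hl : ∀ e, l e ≠ 0) (hl0 : l ≠ 0) :
    ((Bigraph.diag G).fiber (Projectivization.mk ℂ l hl0)).encard =
      (normalizedSolutions v₀ v₁ l).encard := by
  have hne : ∀ z : normalizedSolutions v₀ v₁ l, edgeProd G z.1.1 z.1.2 ≠ 0 :=
    fun z => z.2.2.2.2.trans_ne hl0
  let φ : normalizedSolutions v₀ v₁ l →
      (Bigraph.diag G).fiber (Projectivization.mk ℂ l hl0) := fun z =>
    ⟨_, mk_mem_fiber hl0 z.2.2.2.2 (mk_ne_zero_of_edgeProd_ne_zero (hne z)).1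
      (mk_ne_zero_of_edgeProd_ne_zero (hne z)).2⟩
  refine (Set.encard_congr (Equiv.ofBijective φ ⟨?_, ?_⟩)).symm
  · rintro ⟨⟨x, y⟩, hx₀, hy₀, hx₁, hxy⟩ ⟨⟨x', y'⟩, hx₀', hy₀', hx₁', hxy'⟩ heq
    have heq' := congrArg Subtype.val heq
    obtain ⟨h1, h2⟩ := Prod.mk.inj heq'
    obtain ⟨a, ha⟩ := (Projectivization.mk_eq_mk_iff' ..).mp h1
    obtain ⟨b, hb⟩ := (Projectivization.mk_eq_mk_iff' ..).mp h2
    have ha' := (mk_eq_mk_iff_of_preconnected hG hx₀ hx₀' a).mp ha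
    have hb' := (mk_eq_mk_iff_of_preconnected hG hy₀ hy₀' b).mp hb
    dsimp only at hx₀ hy₀ hx₁ hx₀' hy₀' hx₁' hxy hxy' ha' hb'
    have ha1 : a = 1 := by
      have := congrFun ha' v₁
      rw [Pi.smul_apply, hx₁, hx₁', smul_eq_mul, mul_one] at this
      exact this.symm
    subst ha1
    -- With x fixed, the nonzero label of {v₁, v₀} fixes the scale of y.
    have hb1 : b = 1 := by
      have e1 := (edgeProd_eq_iff _ _ _).mp hxy _ _ h
      have e2 := (edgeProd_eq_iff _ _ _).mp hxy' _ _ h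
      rw [ha', hb', ← e2] at e1
      simp only [Pi.smul_apply, smul_eq_mul, one_mul] at e1
      have hne' := e2.trans_ne (hl _)
      refine mul_right_cancel₀ hne' ?_
      linear_combination e1
    subst hb1
    rw [one_smul] at ha' hb'
    subst ha' hb'
    rfl
  · rintro ⟨⟨p, q⟩, hpq, hmk⟩
    obtain ⟨x, hx⟩ := Submodule.Quotient.mk_surjective _ p.rep
    obtain ⟨y, hy⟩ := Submodule.Quotient.mk_surjective _ q.rep
    obtain ⟨c, hc⟩ := (Projectivization.mk_eq_mk_iff' ..).mp hmk
    dsimp only at hc hpq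
    rw [← hx, ← hy, prodVec_mk] at hc hpq
    have hc0 : c ≠ 0 := by
      rintro rfl
      exact hpq (by rw [← hc, zero_smul])
    have hxy := (edgeProd_eq_iff x y _).mp hc.symm
    have hα : x v₁ - x v₀ ≠ 0 :=
      left_ne_zero_of_mul ((hxy v₁ v₀ h).trans_ne (mul_ne_zero hc0 (hl _)))
    -- The representatives have edge product `c • l`; the factor `c⁻¹` in y corrects it to `l`.
    refine ⟨⟨(fun v => (x v₁ - x v₀)⁻¹ * (x v - x v₀),
      fun v => (x v₁ - x v₀) * c⁻¹ * (y v - y v₀)), ⟨by simp, by simp, inv_mul_cancel₀ hα, ?_⟩⟩, ?_⟩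
    · rw [edgeProd_eq_iff]
      intro u v huv
      have := hxy u v huv
      rw [Pi.smul_apply, smul_eq_mul] at this
      rw [← mul_right_inj' hc0, ← this]
      field_simp
      ring
    · have hmkp : ∀ (a : ℂ) (w : V → ℂ),
          (Submodule.Quotient.mk (fun v => a * (w v - w v₀)) : PosSpace fun e : G.edgeSet => e.1) =
            a • Submodule.Quotient.mk w := by
        intro a w
        rw [← Submodule.Quotient.mk_smul, Submodule.Quotient.eq]
        convert const_mem_ker_edgeDiff (G := G) (-(a * w v₀)) using 1
        funext v
        simp
        ring
      refine Subtype.ext (Prod.ext ?_ ?_)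
      · refine Eq.trans ?_ p.mk_rep
        refine (Projectivization.mk_eq_mk_iff' ..).mpr ⟨(x v₁ - x v₀)⁻¹, ?_⟩
        rw [← hx]
        exact (hmkp _ _).symm
      · refine Eq.trans ?_ q.mk_rep
        refine (Projectivization.mk_eq_mk_iff' ..).mpr ⟨(x v₁ - x v₀) * c⁻¹, ?_⟩
        rw [← hy]
        exact (hmkp _ _).symm

end Fiber

/-! ### General points of the projective space -/

section Homogeneous

open MvPolynomial

variable {σ : Type*}

theorem eval_smul_eq_of_isHomogeneous {F : MvPolynomial σ ℂ} {n : ℕ} (hF : F.IsHomogeneous n)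
    (t : ℂ) (l : σ → ℂ) : eval (t • l) F = t ^ n * eval l F := by
  rw [eval_eq, eval_eq, Finset.mul_sum]
  refine Finset.sum_congr rfl fun d hd => ?_
  have hdeg : ∑ i ∈ d.support, d i = n := by
    rw [← hF (mem_support_iff.mp hd), Finsupp.weight_apply]
    simp [Finsupp.sum]
  simp only [Pi.smul_apply, smul_eq_mul, mul_pow, Finset.prod_mul_distrib, Finset.prod_pow_eq_pow_sum,
    hdeg]
  ring

/-- Off the zero set of a suitable nonzero homogeneous polynomial, a given nonzero polynomial does
not vanish identically on a line through the origin. -/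
theorem exists_isHomogeneous_forall_exists_eval_smul_ne_zero {F : MvPolynomial σ ℂ} (hF : F ≠ 0) :
    ∃ (n : ℕ) (H : MvPolynomial σ ℂ), H.IsHomogeneous n ∧ H ≠ 0 ∧
      ∀ l : σ → ℂ, eval l H ≠ 0 → ∃ t : ℂ, t ≠ 0 ∧ eval (t • l) F ≠ 0 := by
  obtain ⟨n, hn⟩ : ∃ n, homogeneousComponent n F ≠ 0 := by
    by_contra! hcon
    apply hF
    rw [← sum_homogeneousComponent F]
    exact Finset.sum_eq_zero fun i _ => hcon i
  refine ⟨n, homogeneousComponent n F, homogeneousComponent_isHomogeneous n F, hn, fun l hl => ?_⟩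
  let P : Polynomial ℂ := ∑ i ∈ Finset.range (F.totalDegree + 1),
    Polynomial.C (eval l (homogeneousComponent i F)) * Polynomial.X ^ i
  have hP : ∀ t, P.eval t = eval (t • l) F := by
    intro t
    conv_rhs => rw [← sum_homogeneousComponent F]
    rw [map_sum, Polynomial.eval_finsetSum]
    refine Finset.sum_congr rfl fun i _ => ?_
    rw [eval_smul_eq_of_isHomogeneous (homogeneousComponent_isHomogeneous i F),
      Polynomial.eval_C_mul, Polynomial.eval_pow, Polynomial.eval_X, mul_comm]
  have hP0 : P ≠ 0 := by
    intro h0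
    have := congrArg (fun Q => Polynomial.coeff Q n) h0
    simp only [P, Polynomial.finsetSum_coeff, Polynomial.coeff_C_mul_X_pow, Polynomial.coeff_zero,
      Finset.sum_ite_eq, Finset.mem_range] at this
    by_cases hlt : n < F.totalDegree + 1
    · rw [if_pos hlt] at this
      exact hl this
    · exact hn (homogeneousComponent_eq_zero n F (by omega))
  by_contra! hcon
  -- The factor `X` absorbs t = 0, where nothing is known about `P`.
  have h0 : Polynomial.X * P = 0 := by
    refine Polynomial.funext fun t => ?_
    by_cases ht : t = 0
    · simp [ht]
    · simp [hP, hcon t ht]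
  exact (mul_ne_zero Polynomial.X_ne_zero hP0) h0

end Homogeneous

/-- The rational map of `(G, G)` has a degree if `G` is a Laman graph. -/
theorem IsLaman.exists_hasDegree {V : Type*} [Fintype V] {G : SimpleGraph V} (hG : IsLaman G) :
    ∃ d, (Bigraph.diag G).HasDegree d := by
  classical
  obtain ⟨v₁, v₀, h⟩ := hG.exists_adj
  obtain ⟨d, F, hF, hd⟩ := hG.exists_encard_normalizedSolutions_eq h.ne
  -- The product of the variables forces all labels to be nonzero.
  have hF' : F * ∏ e : G.edgeSet, MvPolynomial.X e ≠ 0 :=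
    mul_ne_zero hF (Finset.prod_ne_zero_iff.mpr fun e _ => MvPolynomial.X_ne_zero e)
  obtain ⟨n, H, hH, hH0, hHF⟩ := exists_isHomogeneous_forall_exists_eval_smul_ne_zero hF'
  refine ⟨d, n, H, hH, hH0, fun p hp => ?_⟩
  obtain ⟨t, ht, hFt⟩ := hHF _ hp
  rw [map_mul, map_prod] at hFt
  have hl : ∀ e, (t • p.rep) e ≠ 0 := fun e => by
    simpa using Finset.prod_ne_zero_iff.mp (right_ne_zero_of_mul hFt) e (Finset.mem_univ e)
  have hl0 : t • p.rep ≠ 0 := smul_ne_zero ht p.rep_nonzero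
  have hmk : Projectivization.mk ℂ (t • p.rep) hl0 = p := by
    refine Eq.trans ?_ p.mk_rep
    exact (Projectivization.mk_eq_mk_iff' ..).mpr ⟨t, rfl⟩
  rw [← hd _ (left_ne_zero_of_mul hFt), ← encard_fiber hG.preconnected h _ hl hl0, hmk]

end LamanCount

end

/-- For a Laman graph `G`, the rational map of the bigraph `(G, G)` has a degree, which is the
Laman number of `(G, G)`, and for a general labeling the number of compatible complex realizations,
up to direct isometries, is finite and equal to it. -/
theorem proposition3 {V : Type*} [Fintype V] (G : SimpleGraph V) (hG : LamanCount.IsLaman G) :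
    (LamanCount.Bigraph.diag G).HasDegree (LamanCount.Bigraph.diag G).lamanNumber ∧
      LamanCount.ForGeneralLabeling fun l : LamanCount.Labeling G =>
        (LamanCount.realizationClasses l).encard =
          ((LamanCount.Bigraph.diag G).lamanNumber : ℕ∞) := by
  classical
  have hdeg : (LamanCount.Bigraph.diag G).HasDegree (LamanCount.Bigraph.diag G).lamanNumber :=
    -- The infimum of a nonempty set of naturals belongs to it, so existence of a degree suffices.
    Nat.sInf_mem (s := {d | (LamanCount.Bigraph.diag G).HasDegree d}) hG.exists_hasDegree
  refine ⟨hdeg, ?_⟩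
  obtain ⟨n, F, hF, hF0, hd⟩ := hdeg
  obtain ⟨v₁, v₀, h⟩ := hG.exists_adj
  refine ⟨F * ∏ e : G.edgeSet, MvPolynomial.X e,
    mul_ne_zero hF0 (Finset.prod_ne_zero_iff.mpr fun e _ => MvPolynomial.X_ne_zero e),
    fun l hFl => ?_⟩
  rw [map_mul, map_prod] at hFl
  have hl : ∀ e, l e ≠ 0 := fun e => by
    simpa using Finset.prod_ne_zero_iff.mp (right_ne_zero_of_mul hFl) e (Finset.mem_univ e)
  have hl0 : l ≠ 0 := fun h0 => hl ⟨s(v₁, v₀), h⟩ (congrFun h0 _)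
  obtain ⟨a, ha⟩ := Projectivization.exists_smul_eq_mk_rep ℂ l hl0
  rw [LamanCount.encard_realizationClasses h l hl,
    ← LamanCount.encard_fiber hG.preconnected h l hl hl0]
  refine hd _ ?_
  -- The chosen representative of [l] is a multiple of `l`, so by homogeneity nonvanishing passes
  -- from `l` to it.
  rw [← ha, Units.smul_def, LamanCount.eval_smul_eq_of_isHomogeneous hF]
  exact mul_ne_zero (pow_ne_zero _ a.ne_zero) (left_ne_zero_of_mul hFl)
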